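/- Let $N\in\mathbb{N}$, let $\mathbb{R}^N$ carry the Euclidean norm, let $A$ be an arbitrary real $N\times N$ matrix (no symmetry or definiteness of $A$ or of $A^*A$ is assumed), and let $F:\mathbb{R}^N\to\mathbb{R}^N$ be locally Lipschitz. For $x\in\mathbb{R}^N$ let $\partial F(x)$ denote Clarke's generalized Jacobian of $F$ at $x$, that is, the convex hull of the set of all matrices of the form $\lim_{m\to\infty} F'(u_m)$, where $u_m\to x$ and $F$ is differentiable at every $u_m$. Assume that (i) $\|Ax-F(x)\|\to\infty$ as $\|x\|\to\infty$; (ii) $\det(A-B)\neq 0$ for every $x\in\mathbb{R}^N$ and every $B\in\partial F(x)$. Then for every $\xi\in\mathbb{R}^N$ the equation $Ax=F(x)+\xi$ has exactly one solution $x\in\mathbb{R}^N$. -/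

import Mathlib

open Filter Topology

/-- The Jacobian matrix of `F : ℝⁿ → ℝᵏ` at `x` (meaningful where `F` is differentiable):
its `(i, j)` entry is the `j`-th partial derivative of the `i`-th component of `F`. -/
noncomputable def jacobianMatrix {n k : ℕ}
    (F : EuclideanSpace ℝ (Fin n) → EuclideanSpace ℝ (Fin k))
    (x : EuclideanSpace ℝ (Fin n)) : Matrix (Fin k) (Fin n) ℝ :=
  Matrix.of fun i j => fderiv ℝ F x (EuclideanSpace.single j 1) i

/-- Clarke's generalized Jacobian `∂F(x)` of `F : ℝⁿ → ℝᵏ`: the convex hull of all limits of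
Jacobian matrices `JF(uₘ)` along sequences `uₘ → x` of points of differentiability of `F`. -/
def generalizedJacobian {n k : ℕ}
    (F : EuclideanSpace ℝ (Fin n) → EuclideanSpace ℝ (Fin k))
    (x : EuclideanSpace ℝ (Fin n)) : Set (Matrix (Fin k) (Fin n) ℝ) :=
  convexHull ℝ {B | ∃ u : ℕ → EuclideanSpace ℝ (Fin n),
    (∀ m, DifferentiableAt ℝ F (u m)) ∧ Tendsto u atTop (𝓝 x) ∧
      Tendsto (fun m => jacobianMatrix F (u m)) atTop (𝓝 B)}

/-! Put f = A - F. Its generalized derivatives at x are the operators A - B with B in ∂F(x), hence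
invertible. They form a compact convex set, so some compact convex neighbourhood K still consists of
invertible operators, and by upper semicontinuity K contains all derivatives of f near x. The mean
value theorem gives f z - f y = L (z - y) with L ∈ K, so f is injective near x; minimizing ‖f - ξ‖
shows that f is open. Thus f is a local homeomorphism, coercivity makes it proper, and a proper
local homeomorphism between simply connected spaces is bijective. -/

/-! ### Mean value theorem for Lipschitz maps -/

-- The segment from y to y + v may lie in the null set where g is not differentiable. Averaging over
-- a small ball of starting points z removes this: t ↦ ∫ g (z + t • v) is differentiable for every
-- t, with derivative at most s times the volume of the ball.
open MeasureTheory Metric Set in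
theorem LipschitzWith.sub_le_of_ae_fderiv_apply_le {V : Type*} [NormedAddCommGroup V]
    [NormedSpace ℝ V] [FiniteDimensional ℝ V] [MeasurableSpace V] [BorelSpace V]
    (μ : Measure V) [μ.IsAddHaarMeasure] {g : V → ℝ} {C : NNReal} (hg : LipschitzWith C g)
    {x₀ v y : V} {r s : ℝ}
    (hs : ∀ᵐ u ∂μ, u ∈ ball x₀ r → fderiv ℝ g u v ≤ s)
    (hy : y ∈ ball x₀ r) (hyv : y + v ∈ ball x₀ r) : g (y + v) - g y ≤ s := by
  by_contra! hlt
  obtain ⟨s', hss', hs'⟩ := exists_between hlt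
  have hcont : Continuous fun z => g (z + v) - g z := by
    have := hg.continuous
    fun_prop
  obtain ⟨η₁, hη₁, hball⟩ := Metric.mem_nhds_iff.1
    (hcont.continuousAt.preimage_mem_nhds (Ioi_mem_nhds hs') : _ ∈ 𝓝 y)
  -- The margin r - ρ keeps all translates of the small ball along the segment inside `ball x₀ r`.
  obtain ⟨ρ, hρ, hρr⟩ := exists_between (max_lt (mem_ball.1 hy) (mem_ball.1 hyv))
  set η := min η₁ (r - ρ) with hη
  have hηpos : 0 < η := lt_min hη₁ (sub_pos.2 hρr)
  have hfin : IsFiniteMeasure (μ.restrict (ball y η)) :=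
    ⟨by simpa using measure_ball_lt_top⟩
  have hmem : ∀ t ∈ Icc (0 : ℝ) 1, ∀ z ∈ ball y η, z + t • v ∈ ball x₀ r := by
    intro t ht z hz
    have h1 : y + t • v ∈ ball x₀ ρ :=
      (convex_ball x₀ ρ).add_smul_mem (mem_ball.2 ((le_max_left _ _).trans_lt hρ))
        (mem_ball.2 ((le_max_right _ _).trans_lt hρ)) ht
    have h2 : dist (z + t • v) (y + t • v) < r - ρ := by
      simpa using lt_of_lt_of_le (mem_ball.1 hz) (min_le_right _ _)
    have := dist_triangle (z + t • v) (y + t • v) x₀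
    rw [mem_ball] at h1 ⊢
    linarith
  have hint : ∀ t : ℝ, Integrable (fun z => g (z + t • v)) (μ.restrict (ball y η)) := by
    intro t
    have h : Continuous fun z => g (z + t • v) := by
      have := hg.continuous
      fun_prop
    exact (h.continuousOn.integrableOn_compact (isCompact_closedBall y η)).mono_set
      ball_subset_closedBall
  have hderiv : ∀ t : ℝ, Integrable (fun z => fderiv ℝ g (z + t • v) v) (μ.restrict (ball y η)) ∧
      HasDerivAt (fun t => ∫ z in ball y η, g (z + t • v) ∂μ)
        (∫ z in ball y η, fderiv ℝ g (z + t • v) v ∂μ) t := by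
    intro t
    refine hasDerivAt_integral_of_dominated_loc_of_lip (bound := fun _ => C * ‖v‖) univ_mem
      (Eventually.of_forall fun t => (hint t).aestronglyMeasurable) (hint t) ?_ ?_
      (integrable_const _) ?_
    · exact ((measurable_fderiv_apply_const ℝ g v).comp
        (measurable_add_const (t • v))).aestronglyMeasurable
    · refine Eventually.of_forall fun z => LipschitzOnWith.of_dist_le_mul fun a _ b _ => ?_
      refine (hg.dist_le_mul _ _).trans_eq ?_
      rw [dist_add_left, dist_eq_norm, ← sub_smul, norm_smul, Real.coe_nnabs,
        abs_of_nonneg (by positivity), dist_eq_norm]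
      ring
    · refine ae_restrict_of_ae ?_
      have h := (measurePreserving_add_right μ (t • v)).quasiMeasurePreserving.ae
        (hg.ae_differentiableAt (μ := μ))
      filter_upwards [h] with z hz
      have h1 : HasDerivAt (fun t : ℝ => z + t • v) v t := by
        simpa using ((hasDerivAt_id t).smul_const v).const_add z
      exact hz.hasFDerivAt.comp_hasDerivAt t h1
  have hle : ∀ t ∈ Icc (0 : ℝ) 1,
      ∫ z in ball y η, fderiv ℝ g (z + t • v) v ∂μ ≤ s * μ.real (ball y η) := by
    intro t ht
    have h := (measurePreserving_add_right μ (t • v)).quasiMeasurePreserving.ae hs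
    calc ∫ z in ball y η, fderiv ℝ g (z + t • v) v ∂μ ≤ ∫ z in ball y η, s ∂μ := by
          refine integral_mono_ae (hderiv t).1 (integrable_const _) ?_
          filter_upwards [ae_restrict_of_ae h, ae_restrict_mem measurableSet_ball] with z hz hzb
          exact hz (hmem t ht z hzb)
      _ = s * μ.real (ball y η) := by simp [mul_comm]
  have hupper := Convex.image_sub_le_mul_sub_of_deriv_le (convex_Icc (0 : ℝ) 1)
    (f := fun t => ∫ z in ball y η, g (z + t • v) ∂μ)
    (fun t _ => (hderiv t).2.continuousAt.continuousWithinAt)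
    (fun t _ => (hderiv t).2.differentiableAt.differentiableWithinAt)
    (C := s * μ.real (ball y η))
    (fun t ht => by rw [(hderiv t).2.deriv]; exact hle t (interior_subset ht))
    0 (by simp) 1 (by simp) zero_le_one
  have hlower : s' * μ.real (ball y η) ≤
      ∫ z in ball y η, (g (z + (1 : ℝ) • v) - g (z + (0 : ℝ) • v)) ∂μ := by
    calc s' * μ.real (ball y η) = ∫ z in ball y η, s' ∂μ := by simp [mul_comm]
      _ ≤ _ := by
        refine integral_mono_ae (integrable_const _) ((hint 1).sub (hint 0)) ?_
        filter_upwards [ae_restrict_mem measurableSet_ball] with z hz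
        have := hball (ball_subset_ball (min_le_left _ _) hz)
        simpa using le_of_lt this
  rw [integral_sub (hint 1) (hint 0)] at hlower
  have hpos : 0 < μ.real (ball y η) :=
    ENNReal.toReal_pos (measure_ball_pos μ y hηpos).ne' measure_ball_lt_top.ne
  simp only [sub_zero, mul_one] at hupper
  exact absurd (hlower.trans hupper) (not_le.2 (mul_lt_mul_of_pos_right hss' hpos))

/-- By Carathéodory, at most dim V + 1 points suffice, so the hull is a finite union of continuous
images of compact sets. -/
theorem IsCompact.convexHull_of_finiteDimensional {V : Type*} [NormedAddCommGroup V]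
    [NormedSpace ℝ V] [FiniteDimensional ℝ V] {s : Set V} (hs : IsCompact s) :
    IsCompact (convexHull ℝ s) := by
  have key : convexHull ℝ s = ⋃ k : Fin (Module.finrank ℝ V + 2),
      (fun p : (Fin k → ℝ) × (Fin k → V) => ∑ i, p.1 i • p.2 i) ''
        (stdSimplex ℝ (Fin k) ×ˢ Set.univ.pi fun _ => s) := by
    apply Set.Subset.antisymm
    · intro x hx
      obtain ⟨ι, _, z, w, hz, hind, hw, hw1, rfl⟩ := eq_pos_convex_span_of_mem_convexHull hx
      have hcard : Fintype.card ι < Module.finrank ℝ V + 2 := by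
        have := hind.card_le_finrank_succ
        have := Submodule.finrank_le (vectorSpan ℝ (Set.range z))
        omega
      let e := Fintype.equivFin ι
      refine Set.mem_iUnion.2 ⟨⟨_, hcard⟩, (w ∘ e.symm, z ∘ e.symm),
        ⟨⟨fun i => (hw _).le, ?_⟩, fun i _ => hz ⟨_, rfl⟩⟩, ?_⟩
      · rw [← hw1]; exact e.symm.sum_comp w
      · exact e.symm.sum_comp fun i => w i • z i
    · refine Set.iUnion_subset fun k => ?_
      rintro _ ⟨⟨w, z⟩, ⟨hw, hz⟩, rfl⟩
      exact (convex_convexHull ℝ s).sum_mem (fun i _ => hw.1 i) hw.2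
        fun i _ => subset_convexHull ℝ s (hz i trivial)
  rw [key]
  refine isCompact_iUnion fun k => IsCompact.image ?_ (by fun_prop)
  exact (isCompact_stdSimplex ℝ _).prod (isCompact_univ_pi fun _ => hs)

open MeasureTheory Metric Set in
/-- Mean value theorem for Lipschitz maps whose derivatives lie in a compact convex set. -/
theorem LipschitzOnWith.exists_mem_sub_eq_apply {V W : Type*} [NormedAddCommGroup V]
    [NormedSpace ℝ V] [FiniteDimensional ℝ V] [NormedAddCommGroup W] [NormedSpace ℝ W]
    [FiniteDimensional ℝ W] {f : V → W} {C : NNReal} {x₀ : V} {r : ℝ}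
    (hf : LipschitzOnWith C f (ball x₀ r)) {K : Set (V →L[ℝ] W)} (hK : IsCompact K)
    (hKc : Convex ℝ K) (hd : ∀ u ∈ ball x₀ r, DifferentiableAt ℝ f u → fderiv ℝ f u ∈ K)
    {y z : V} (hy : y ∈ ball x₀ r) (hz : z ∈ ball x₀ r) : ∃ L ∈ K, f z - f y = L (z - y) := by
  borelize V
  obtain ⟨f', hf', heq⟩ := hf.extend_finite_dimension
  by_contra! hne
  -- A functional l separating f z - f y from the vectors L (z - y), L ∈ K, reduces the claim to the
  -- scalar function l ∘ f'.
  let ev : (V →L[ℝ] W) →L[ℝ] W := ContinuousLinearMap.apply ℝ W (z - y)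
  obtain ⟨l, s, hl, hs⟩ := geometric_hahn_banach_closed_point (s := ev '' K) (x := f z - f y)
    (hKc.linear_image ev.toLinearMap) (hK.image ev.continuous).isClosed
    (by rintro ⟨L, hL, h⟩; exact hne L hL h.symm)
  have h := (l.lipschitz.comp hf').sub_le_of_ae_fderiv_apply_le Measure.addHaar (v := z - y)
    (s := s) (x₀ := x₀) (r := r) (y := y) ?_ hy (by simpa using hz)
  · simp only [Function.comp_apply, add_sub_cancel, ← heq hy, ← heq hz, ← map_sub] at h
    linarith
  · filter_upwards [hf'.ae_differentiableAt (μ := Measure.addHaar)] with u hu hub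
    have hev : f' =ᶠ[𝓝 u] f := (heq.eventuallyEq_of_mem (isOpen_ball.mem_nhds hub)).symm
    rw [fderiv_comp u l.differentiableAt hu, hev.fderiv_eq, l.fderiv]
    exact (hl _ ⟨_, hd u hub (hev.differentiableAt_iff.1 hu), rfl⟩).le

/-! ### Generalized derivatives -/

/-- The cluster values at `x` of the derivative of `f` along its points of differentiability. -/
def limitingDerivatives {V W : Type*} [NormedAddCommGroup V] [NormedSpace ℝ V]
    [NormedAddCommGroup W] [NormedSpace ℝ W] (f : V → W) (x : V) : Set (V →L[ℝ] W) :=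
  {L | MapClusterPt L (𝓝 x ⊓ 𝓟 {u | DifferentiableAt ℝ f u}) (fderiv ℝ f)}

section limitingDerivatives

open Metric Set

variable {V W : Type*} [NormedAddCommGroup V] [NormedSpace ℝ V]
    [NormedAddCommGroup W] [NormedSpace ℝ W] {f : V → W} {x : V}

theorem exists_seq_of_mem_limitingDerivatives {L : V →L[ℝ] W} (h : L ∈ limitingDerivatives f x) :
    ∃ u : ℕ → V, (∀ m, DifferentiableAt ℝ f (u m)) ∧ Tendsto u atTop (𝓝 x) ∧
      Tendsto (fun m => fderiv ℝ f (u m)) atTop (𝓝 L) := by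
  have : (comap (fderiv ℝ f) (𝓝 L) ⊓ (𝓝 x ⊓ 𝓟 {u | DifferentiableAt ℝ f u})).NeBot := by
    rw [inf_comm, neBot_inf_comap_iff_map, inf_comm]
    exact h
  obtain ⟨u, hu⟩ := exists_seq_tendsto
    (comap (fderiv ℝ f) (𝓝 L) ⊓ (𝓝 x ⊓ 𝓟 {u | DifferentiableAt ℝ f u}))
  rw [tendsto_inf, tendsto_inf, tendsto_comap_iff, tendsto_principal] at hu
  obtain ⟨h1, h2, h3⟩ := hu
  obtain ⟨n, hn⟩ := eventually_atTop.1 h3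
  exact ⟨fun m => u (m + n), fun m => hn _ (by omega), h2.comp (tendsto_add_atTop_nat n),
    h1.comp (tendsto_add_atTop_nat n)⟩

/-- Differentiability is not needed, as `fderiv` is 0 elsewhere. -/
theorem LipschitzOnWith.eventually_fderiv_mem_closedBall {C : NNReal} {t : Set V}
    (hf : LipschitzOnWith C f t) (ht : t ∈ 𝓝 x) :
    ∀ᶠ u in 𝓝 x, fderiv ℝ f u ∈ closedBall (0 : V →L[ℝ] W) C := by
  filter_upwards [eventually_mem_nhds_iff.2 ht] with u hu
  simpa using norm_fderiv_le_of_lipschitzOn ℝ hu hf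

variable [FiniteDimensional ℝ V] [FiniteDimensional ℝ W]

theorem LocallyLipschitz.isCompact_limitingDerivatives (hf : LocallyLipschitz f) (x : V) :
    IsCompact (limitingDerivatives f x) := by
  obtain ⟨C, t, ht, hft⟩ := hf x
  refine (isCompact_closedBall (0 : V →L[ℝ] W) C).of_isClosed_subset ?_ fun L hL => ?_
  · exact isClosed_setOfPred_clusterPt
  · refine isClosed_closedBall.mem_of_mapClusterPt hL ?_
    exact (hft.eventually_fderiv_mem_closedBall ht).filter_mono inf_le_left

/-- Upper semicontinuity: derivatives outside O at points tending to x would be bounded, hence would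
cluster at a limiting derivative outside O. -/
theorem LocallyLipschitz.eventually_fderiv_mem (hf : LocallyLipschitz f) {O : Set (V →L[ℝ] W)}
    (hO : IsOpen O) (h : limitingDerivatives f x ⊆ O) :
    ∀ᶠ u in 𝓝 x, DifferentiableAt ℝ f u → fderiv ℝ f u ∈ O := by
  obtain ⟨C, t, ht, hft⟩ := hf x
  by_contra hcon
  have hne : (map (fderiv ℝ f) (𝓝 x ⊓ 𝓟 {u | DifferentiableAt ℝ f u}) ⊓ 𝓟 Oᶜ).NeBot := by
    rw [← frequently_mem_iff_neBot, frequently_map, frequently_inf_principal]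
    exact (not_eventually.1 hcon).mono fun u hu => Classical.not_imp.1 hu
  have hle : map (fderiv ℝ f) (𝓝 x ⊓ 𝓟 {u | DifferentiableAt ℝ f u}) ⊓ 𝓟 Oᶜ ≤
      𝓟 (closedBall (0 : V →L[ℝ] W) C) :=
    inf_le_left.trans (le_principal_iff.2
      ((hft.eventually_fderiv_mem_closedBall ht).filter_mono inf_le_left))
  obtain ⟨L, -, hL⟩ := isCompact_closedBall (0 : V →L[ℝ] W) C hle
  exact isClosed_iff_clusterPt.1 hO.isClosed_compl L (hL.mono inf_le_right)
    (h (hL.mono inf_le_left))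

end limitingDerivatives

/-! ### Local and global inversion -/

open Metric Set in
/-- A map with mean value operators in a compact convex set of invertible operators is open
at the centre of the ball. -/
theorem nhds_le_map_nhds_of_forall_exists_sub_eq {V : Type*} [NormedAddCommGroup V]
    [InnerProductSpace ℝ V] [FiniteDimensional ℝ V] {f : V → V} {x₀ : V} {r : ℝ} (hr : 0 < r)
    (hf : ContinuousOn f (ball x₀ r)) {K : Set (V →L[ℝ] V)} (hK : IsCompact K)
    (hKc : Convex ℝ K) (hKu : ∀ L ∈ K, IsUnit L)
    (h : ∀ y ∈ ball x₀ r, ∀ z ∈ ball x₀ r, ∃ L ∈ K, f z - f y = L (z - y)) :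
    𝓝 (f x₀) ≤ map f (𝓝 x₀) := by
  have hinj : ∀ L ∈ K, Function.Bijective L := fun L hL =>
    ContinuousLinearMap.isUnit_iff_bijective.1 (hKu L hL)
  refine (nhds_basis_ball.map f).ge_iff.2 fun ε hε => ?_
  obtain ⟨ρ, hρ, hρ'⟩ := exists_between (lt_min hr hε)
  obtain ⟨hρr, hρε⟩ := lt_min_iff.1 hρ'
  have hsub : closedBall x₀ ρ ⊆ ball x₀ r := closedBall_subset_ball hρr
  obtain ⟨m, hm, hsphere⟩ := (isCompact_sphere x₀ ρ).exists_forall_le'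
    (f := fun y => ‖f y - f x₀‖) (a := 0)
    (((hf.mono (sphere_subset_closedBall.trans hsub)).sub continuousOn_const).norm) (by
      intro y hy
      obtain ⟨L, hL, hLy⟩ := h x₀ (mem_ball_self hr) y (hsub (sphere_subset_closedBall hy))
      rw [hLy, norm_pos_iff, (map_ne_zero_iff _ (hinj L hL).1), ← norm_pos_iff,
        ← dist_eq_norm, mem_sphere.1 hy]
      exact hρ)
  -- Within m / 2 of f x₀, a minimizer of ‖f - ξ‖ cannot lie on the sphere, where ‖f - f x₀‖ ≥ m.
  refine mem_of_superset (ball_mem_nhds _ (half_pos hm)) fun ξ hξ => ?_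
  obtain ⟨x, hx, hmin⟩ := (isCompact_closedBall x₀ ρ).exists_isMinOn
    (nonempty_closedBall.2 hρ.le) (f := fun y => ‖f y - ξ‖)
    (((hf.mono hsub).sub continuousOn_const).norm)
  have hx₀ : ‖f x - ξ‖ ≤ ‖f x₀ - ξ‖ := hmin (mem_closedBall_self hρ.le)
  rw [mem_ball, dist_comm, dist_eq_norm] at hξ
  have hxρ : x ∈ ball x₀ ρ := by
    rcases (mem_closedBall.1 hx).lt_or_eq with hlt | heq
    · exact hlt
    · have h1 := hsphere x heq
      have h2 : ‖f x - f x₀‖ ≤ ‖f x - ξ‖ + ‖f x₀ - ξ‖ := by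
        rw [norm_sub_rev (f x₀) ξ]; exact norm_sub_le_norm_sub_add_norm_sub _ _ _
      linarith
  refine ⟨x, ball_subset_ball hρε.le hxρ, ?_⟩
  by_contra hne
  set w := f x - ξ with hw
  have hw0 : w ≠ 0 := sub_ne_zero.2 hne
  -- Since every L ∈ K is onto, 0 is not among the L* w. Separating it from them gives one v with
  -- ⟨w, L v⟩ > u > 0 for all L ∈ K, so a small step along -v lowers ‖f - ξ‖.
  have hcomp : IsCompact ((fun L : V →L[ℝ] V => L.adjoint w) '' K) :=
    hK.image (by fun_prop)
  have hconv : Convex ℝ ((fun L : V →L[ℝ] V => L.adjoint w) '' K) := by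
    rintro _ ⟨L₁, h₁, rfl⟩ _ ⟨L₂, h₂, rfl⟩ a b ha hb hab
    exact ⟨a • L₁ + b • L₂, hKc h₁ h₂ ha hb hab, by simp⟩
  obtain ⟨φ, u, hu0, hu⟩ := geometric_hahn_banach_point_closed hconv hcomp.isClosed (x := 0) (by
    rintro ⟨L, hL, h0⟩
    obtain ⟨v, hv⟩ := (hinj L hL).2 w
    have h0' : inner ℝ (L.adjoint w) v = 0 := by simp [show L.adjoint w = 0 from h0]
    rw [ContinuousLinearMap.adjoint_inner_left, hv, inner_self_eq_zero] at h0'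
    exact hw0 h0')
  rw [map_zero] at hu0
  set v := (InnerProductSpace.toDual ℝ V).symm φ with hv
  have hLv : ∀ L ∈ K, u < inner ℝ w (L v) := by
    intro L hL
    have := hu _ ⟨L, hL, rfl⟩
    rwa [← InnerProductSpace.toDual_symm_apply, ← hv, real_inner_comm,
      ContinuousLinearMap.adjoint_inner_left] at this
  obtain ⟨M, hM⟩ := hK.isBounded.exists_norm_le
  have hev : ∀ᶠ t : ℝ in 𝓝[>] 0, x - t • v ∈ ball x₀ ρ ∧ t * (M * ‖v‖) ^ 2 < 2 * u := by
    refine nhdsWithin_le_nhds (Filter.Eventually.and ?_ ?_)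
    · have hc : Continuous fun t : ℝ => x - t • v := by fun_prop
      exact hc.continuousAt.preimage_mem_nhds (isOpen_ball.mem_nhds (by simpa using hxρ))
    · have hc : Continuous fun t : ℝ => t * (M * ‖v‖) ^ 2 := by fun_prop
      exact hc.continuousAt.eventually_lt continuousAt_const (by simpa using hu0)
  obtain ⟨t, ⟨ht1, ht2⟩, ht0⟩ := (hev.and self_mem_nhdsWithin).exists
  replace ht0 : 0 < t := ht0
  obtain ⟨L, hL, hLt⟩ := h x (hsub hx) _ (hsub (ball_subset_closedBall ht1))
  have hle : ‖w‖ ≤ ‖f (x - t • v) - ξ‖ := hmin (ball_subset_closedBall ht1)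
  have heq : f (x - t • v) - ξ = w - t • L v := by
    rw [sub_sub_cancel_left, map_neg, map_smul] at hLt
    rw [hw, ← sub_add_sub_cancel _ (f x) ξ, hLt]; abel
  have hsq : ‖w - t • L v‖ ^ 2 = ‖w‖ ^ 2 - 2 * t * inner ℝ w (L v) + t ^ 2 * ‖L v‖ ^ 2 := by
    rw [norm_sub_sq_real, inner_smul_right, norm_smul, mul_pow, Real.norm_eq_abs, sq_abs]; ring
  rw [heq] at hle
  have h1 : ‖w‖ ^ 2 ≤ ‖w - t • L v‖ ^ 2 := by gcongr
  have h2 : ‖L v‖ ^ 2 ≤ (M * ‖v‖) ^ 2 := by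
    gcongr
    exact L.le_of_opNorm_le (hM L hL) v
  have h3 : t * (t * ‖L v‖ ^ 2) < t * (2 * inner ℝ w (L v)) := by
    refine mul_lt_mul_of_pos_left ?_ ht0
    have := mul_le_mul_of_nonneg_left h2 ht0.le
    have := hLv L hL
    linarith
  nlinarith

/-- **Hadamard's global inverse function theorem**, topological form. -/
theorem IsLocalHomeomorph.bijective_of_isProperMap {X Y : Type*} [TopologicalSpace X]
    [TopologicalSpace Y] [T2Space X] [T1Space Y] [PathConnectedSpace X] [SimplyConnectedSpace X]
    [LocallyPathConnectedSpace X] [SimplyConnectedSpace Y] [LocallyPathConnectedSpace Y]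
    {f : X → Y} (hf : IsLocalHomeomorph f) (hp : IsProperMap f) : Function.Bijective f := by
  have hcov : IsCoveringMap f := by
    rw [isCoveringMap_iff_isCoveringMapOn_univ]
    refine hp.isClosedMap.isCoveringMapOn_of_isLocalHomeomorphOn (fun y _ => ?_)
      (hf.isLocalHomeomorphOn.mono (Set.subset_univ _))
    refine (hp.isCompact_preimage isCompact_singleton).finite ?_
    exact (hf.isLocalHomeomorphOn.mono (Set.subset_univ _)).isDiscrete_of_image
      ((Set.subsingleton_singleton.anti (Set.image_preimage_subset _ _)).isDiscrete)
  obtain ⟨a₀⟩ : Nonempty X := inferInstance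
  -- Sections come from lifting the identity of Y. For injectivity, σ ∘ f and the identity of X both
  -- lift f and agree at a, so they coincide.
  have hsec : ∀ a : X, ∃ σ : C(Y, X), σ (f a) = a ∧ f ∘ σ = id := fun a =>
    (hcov.existsUnique_continuousMap_lifts (ContinuousMap.id Y) (f a) a rfl).exists
  refine ⟨fun a b hab => ?_, fun y => ?_⟩
  · obtain ⟨σ, hσ, hfσ⟩ := hsec a
    have hσf : σ.comp ⟨f, hp.continuous⟩ = ContinuousMap.id X :=
      (hcov.existsUnique_continuousMap_lifts ⟨f, hp.continuous⟩ a a rfl).unique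
        ⟨hσ, by ext x; exact congrFun hfσ (f x)⟩ ⟨rfl, rfl⟩
    have hb : σ (f b) = b := DFunLike.congr_fun hσf b
    rw [← hσ, hab, hb]
  · obtain ⟨σ, -, hfσ⟩ := hsec a₀
    exact ⟨σ y, congrFun hfσ y⟩

open Metric Set in
/-- A locally Lipschitz map all of whose generalized derivatives are invertible is a local
homeomorphism. -/
theorem LocallyLipschitz.isLocalHomeomorph {V : Type*} [NormedAddCommGroup V]
    [InnerProductSpace ℝ V] [FiniteDimensional ℝ V] {f : V → V} (hf : LocallyLipschitz f)
    (hu : ∀ x, ∀ L ∈ convexHull ℝ (limitingDerivatives f x), IsUnit L) :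
    IsLocalHomeomorph f := by
  have key : ∀ x, ∃ r > 0, ∃ K : Set (V →L[ℝ] V), IsCompact K ∧ Convex ℝ K ∧
      (∀ L ∈ K, IsUnit L) ∧
      ∀ y ∈ ball x r, ∀ z ∈ ball x r, ∃ L ∈ K, f z - f y = L (z - y) := by
    intro x
    have hcomp := (hf.isCompact_limitingDerivatives x).convexHull_of_finiteDimensional
    -- The units are open, so a closed thickening of the compact hull stays among them.
    obtain ⟨δ, hδ, hsub⟩ := hcomp.exists_cthickening_subset_open
      (Units.isOpen (R := V →L[ℝ] V)) (hu x)
    have hev := hf.eventually_fderiv_mem (x := x) isOpen_thickening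
      ((subset_convexHull ℝ _).trans (self_subset_thickening hδ _))
    obtain ⟨C, t, ht, hft⟩ := hf x
    obtain ⟨r, hr, hball⟩ := Metric.mem_nhds_iff.1 (inter_mem ht hev)
    refine ⟨r, hr, _, hcomp.cthickening, (convex_convexHull ℝ _).cthickening δ,
      fun L hL => hsub hL, fun y hy z hz => ?_⟩
    exact (hft.mono fun u h => (hball h).1).exists_mem_sub_eq_apply hcomp.cthickening
      ((convex_convexHull ℝ _).cthickening δ)
      (fun u h hd => thickening_subset_cthickening _ _ ((hball h).2 hd)) hy hz
  have hopen : IsOpenMap f := by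
    refine isOpenMap_iff_nhds_le.2 fun x => ?_
    obtain ⟨r, hr, K, hK, hKc, hKu, h⟩ := key x
    exact nhds_le_map_nhds_of_forall_exists_sub_eq hr hf.continuous.continuousOn hK hKc hKu h
  refine isLocalHomeomorph_iff_isOpenEmbedding_restrict.2 fun x => ?_
  obtain ⟨r, hr, K, -, -, hKu, h⟩ := key x
  refine ⟨ball x r, ball_mem_nhds x hr, .of_continuous_injective_isOpenMap
    (hf.continuous.comp continuous_subtype_val) (injOn_iff_injective.1 fun y hy z hz hyz => ?_)
    (hopen.comp isOpen_ball.isOpenMap_subtype_val)⟩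
  obtain ⟨L, hL, hLe⟩ := h y hy z hz
  rw [hyz, sub_self] at hLe
  have hinj := (ContinuousLinearMap.isUnit_iff_bijective.1 (hKu L hL)).1
  exact (sub_eq_zero.1 ((map_eq_zero_iff L hinj).1 hLe.symm)).symm

theorem LocallyLipschitz.bijective_of_tendsto_norm {V : Type*} [NormedAddCommGroup V]
    [InnerProductSpace ℝ V] [FiniteDimensional ℝ V] {f : V → V} (hf : LocallyLipschitz f)
    (hcoercive : Tendsto (fun x => ‖f x‖) (comap norm atTop) atTop)
    (hu : ∀ x, ∀ L ∈ convexHull ℝ (limitingDerivatives f x), IsUnit L) :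
    Function.Bijective f := by
  refine (hf.isLocalHomeomorph hu).bijective_of_isProperMap
    (isProperMap_iff_tendsto_cocompact.2 ⟨hf.continuous, ?_⟩)
  rwa [← Metric.cobounded_eq_cocompact, ← tendsto_norm_atTop_iff_cobounded, ← comap_norm_atTop]

/-! ### Translation to matrices -/

theorem jacobianMatrix_eq_toEuclideanCLM_symm {n : ℕ}
    (F : EuclideanSpace ℝ (Fin n) → EuclideanSpace ℝ (Fin n)) (x : EuclideanSpace ℝ (Fin n)) :
    jacobianMatrix F x = (Matrix.toEuclideanCLM (𝕜 := ℝ)).symm (fderiv ℝ F x) := by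
  set M := (Matrix.toEuclideanCLM (𝕜 := ℝ)).symm (fderiv ℝ F x) with hM
  have hM' : fderiv ℝ F x = Matrix.toEuclideanCLM (n := Fin n) (𝕜 := ℝ) M :=
    ((Matrix.toEuclideanCLM (n := Fin n) (𝕜 := ℝ)).apply_symm_apply _).symm
  ext i j
  rw [jacobianMatrix, hM']
  simp

/-- The map L ↦ A - Φ L is affine and the target convex, so limits of derivatives suffice; there F'
= A - f' at each point of the sequence. -/
theorem sub_mem_generalizedJacobian {n : ℕ} {A : Matrix (Fin n) (Fin n) ℝ}
    {F : EuclideanSpace ℝ (Fin n) → EuclideanSpace ℝ (Fin n)} {x : EuclideanSpace ℝ (Fin n)}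
    {L : EuclideanSpace ℝ (Fin n) →L[ℝ] EuclideanSpace ℝ (Fin n)}
    (hL : L ∈ convexHull ℝ (limitingDerivatives (fun x => Matrix.toEuclideanLin A x - F x) x)) :
    A - (Matrix.toEuclideanCLM (𝕜 := ℝ)).symm L ∈ generalizedJacobian F x := by
  set Φ := (Matrix.toEuclideanCLM (n := Fin n) (𝕜 := ℝ)).symm
  refine convexHull_min (t := {L | A - Φ L ∈ generalizedJacobian F x}) (fun L hL => ?_) ?_ hL
  · obtain ⟨u, hud, hux, huL⟩ := exists_seq_of_mem_limitingDerivatives hL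
    set T := Matrix.toEuclideanCLM (n := Fin n) (𝕜 := ℝ) A with hT
    have hF : ∀ m, HasFDerivAt F
        (T - fderiv ℝ (fun x => Matrix.toEuclideanLin A x - F x) (u m)) (u m) := fun m => by
      refine (T.hasFDerivAt.sub (hud m).hasFDerivAt).congr_of_eventuallyEq
        (Eventually.of_forall fun y => ?_)
      exact (sub_sub_cancel (T y) (F y)).symm
    refine subset_convexHull ℝ _ ⟨u, fun m => (hF m).differentiableAt, hux, ?_⟩
    have hΦ : Continuous Φ :=
      LinearMap.continuous_of_finiteDimensional Φ.toAlgEquiv.toLinearMap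
    have hTA : Φ T = A := (Matrix.toEuclideanCLM (n := Fin n) (𝕜 := ℝ)).symm_apply_apply A
    have := ((hΦ.tendsto L).comp huL).const_sub A
    refine this.congr fun m => ?_
    rw [jacobianMatrix_eq_toEuclideanCLM_symm, (hF m).fderiv, map_sub, hTA]
    rfl
  · intro L₁ h₁ L₂ h₂ a b ha hb hab
    have h := convex_convexHull ℝ _ h₁ h₂ ha hb hab
    have heq : a • (A - Φ L₁) + b • (A - Φ L₂) = A - Φ (a • L₁ + b • L₂) := by
      rw [map_add, map_smul, map_smul, smul_sub, smul_sub, sub_add_sub_comm, ← add_smul, hab,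
        one_smul]
    rwa [heq] at h

theorem mainTheorem5 (N : ℕ) (A : Matrix (Fin N) (Fin N) ℝ)
    (F : EuclideanSpace ℝ (Fin N) → EuclideanSpace ℝ (Fin N))
    (hF : LocallyLipschitz F)
    (hcoercive : Tendsto (fun x => ‖Matrix.toEuclideanLin A x - F x‖)
      (comap (fun x => ‖x‖) atTop) atTop)
    (hdet : ∀ x, ∀ B ∈ generalizedJacobian F x, (A - B).det ≠ 0) :
    ∀ ξ : EuclideanSpace ℝ (Fin N),
      ∃! x : EuclideanSpace ℝ (Fin N), Matrix.toEuclideanLin A x = F x + ξ := by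
  have hLip : LocallyLipschitz fun x => Matrix.toEuclideanLin A x - F x :=
    (Matrix.toEuclideanCLM (n := Fin N) (𝕜 := ℝ) A).lipschitz.locallyLipschitz.sub hF
  have hbij := hLip.bijective_of_tendsto_norm hcoercive fun x L hL => by
    have h := hdet x _ (sub_mem_generalizedJacobian hL)
    rw [sub_sub_cancel] at h
    rw [← MulEquiv.isUnit_map (Matrix.toEuclideanCLM (n := Fin N) (𝕜 := ℝ)).symm]
    exact (Matrix.isUnit_iff_isUnit_det _).2 h.isUnit
  intro ξ
  simpa only [sub_eq_iff_eq_add'] using hbij.existsUnique ξ
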